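/- For elements $x,y$ of a group write $x^y=y^{-1}xy$. Let $H$ be a subgroup of a group $G$. - $H$ is *verbally closed* in $G$ if, for every $n\ge 0$, every element $w$ of the free group $F(x_1,\dots,x_n)$ and every $h\in H$, the equation $w(x_1,\dots,x_n)=h$ has a solution in $H$ whenever it has a solution in $G$. - $H$ is *algebraically closed* in $G$ if, for every $n\ge 0$, every finite system of equations $w_1=1,\dots,w_m=1$ with $w_i\in H*F(x_1,\dots,x_n)$ has a solution in $H$ whenever it has a solution in $G$. - $H$ is a *retract* of $G$ if $H$ is the image of an endomorphism $\rho$ of $G$ with $\rho\circ\rho=\rho$. An abstract group $H$ is *strongly verbally closed* if it is algebraically closed in every group that contains $H$ as a verbally closed subgroup. **Theorem.** Let $K=\langle a,b\mid a^b=a^{-1}\rangle$ be the Klein bottle group. 1. $K$ is not strongly verbally closed. 2. There is a finitely generated group $G$ that contains an isomorphic copy of $K$ as a verbally closed subgroup that is not a retract of $G$. 3. Whenever $K$ is a verbally closed subgroup of a finitely generated group $G$, there is a subgroup $R\le G$ of index at most two such that $K\le R$ and $K$ is a retract of $R$; if moreover $K$ is not a retract of $G$, then $R$ has index exactly two in $G$.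 -/

import Mathlib

universe u

/-- The Klein bottle group `⟨a, b | b⁻¹ a b = a⁻¹⟩`, presented on the generators
`a = FreeGroup.of 0` and `b = FreeGroup.of 1` with the single relator `(b⁻¹ a b) a`. -/
abbrev KleinBottleGroup : Type :=
  PresentedGroup ({(FreeGroup.of 1)⁻¹ * FreeGroup.of 0 * FreeGroup.of 1 * FreeGroup.of 0} :
    Set (FreeGroup (Fin 2)))

namespace Subgroup

/-- `H` is verbally closed in `G`: every equation `w(x₁, …, xₙ) = h`, where `w` is an element of a
free group of finite rank and `h ∈ H`, that has a solution in `G` has a solution in `H`. -/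
def IsVerballyClosed {G : Type*} [Group G] (H : Subgroup G) : Prop :=
  ∀ (n : ℕ) (w : FreeGroup (Fin n)) (h : H),
    (∃ x : Fin n → G, FreeGroup.lift x w = (h : G)) →
      ∃ y : Fin n → H, FreeGroup.lift y w = h

/-- `H` is algebraically closed in `G`: every finite system of equations
`{w = 1 | w ∈ S}` in finitely many unknowns, with coefficients in `H` (so that `S` is a finite
subset of the free product `H * F(x₁, …, xₙ)`), that has a solution in `G` has one in `H`. -/
def IsAlgebraicallyClosed {G : Type*} [Group G] (H : Subgroup G) : Prop :=
  ∀ (n : ℕ) (S : Set (Monoid.Coprod H (FreeGroup (Fin n)))), S.Finite →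
    (∃ x : Fin n → G, ∀ w ∈ S, Monoid.Coprod.lift H.subtype (FreeGroup.lift x) w = 1) →
      ∃ y : Fin n → H, ∀ w ∈ S, Monoid.Coprod.lift (MonoidHom.id H) (FreeGroup.lift y) w = 1

/-- `H` is a retract of `G`: it is the image of an idempotent endomorphism of `G`. -/
def IsRetract {G : Type*} [Group G] (H : Subgroup G) : Prop :=
  ∃ ρ : G →* G, ρ.comp ρ = ρ ∧ ρ.range = H

end Subgroup

/-- The abstract group `H` is strongly verbally closed: it is algebraically closed in every group
that contains (an isomorphic copy of) `H` as a verbally closed subgroup. -/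
def IsStronglyVerballyClosed.{v, w} (H : Type w) [Group H] : Prop :=
  ∀ (G : Type v) [Group G] (f : H →* G), Function.Injective f →
    f.range.IsVerballyClosed → f.range.IsAlgebraicallyClosed

/-!
The Klein bottle group `K = ⟨a, b⟩` has normal form `a ^ i * b ^ j`, and a homomorphism `Γ → K` is the
same thing as a homomorphism `ψ : Γ → ℤ` together with a cocycle `c : Γ → ℤ` twisted by a sign
character `χ`, subject to the single compatibility condition `χ = (-1) ^ ψ`
(`KleinBottleGroup.homOfCocycle`).

Let `K` be verbally closed in a finitely generated group `G`, and let `π : F → G` be a surjection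
from a free group of finite rank. Two ingredients of a retraction always exist on `G`: a
homomorphism `ψ` with `ψ b = 1` (`exists_hom_int_apply_b`), and a character `χ` with `χ a = 1`,
`χ b = -1` and a `χ`-cocycle `c` with `c a = 1` (`exists_signCharacter`). For a fixed character, the
cocycles of `F` form a finitely generated free abelian group, and if no cocycle of the required kind
vanishes on the kernel of `π`, then a single element of the kernel certifies this by a divisibility
obstruction (`exists_cocycle_or_certificate`). Since `F` has only finitely many sign characters,
products of conjugates isolate the contribution of each of them by orthogonality of characters
(`exists_sign_projection`), and the certificates for all of them combine into one word whose value
in `G` is a power of `a` that is not a value of the word in `K`. What may fail is the compatibility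
of `χ` with `ψ`; it holds on the kernel of the sign character `χ * (-1) ^ ψ`, a subgroup of index at
most two, and this subgroup retracts onto `K` (`exists_retract_index_le_two`).

An example where compatibility fails on the whole group is `G = ℤ³ ⋊ (ℤ × (ℤ/2)²)`, where the
generator `b` of `ℤ` inverts `ℤ³`, the Klein four-group acts on the three coordinates through its
three nontrivial characters, and `a = (1, 1, 1)`. Each coordinate is a cocycle whose sign differs
from the parity of `ψ` by one of these characters. Every element of the Klein four-group is in the
kernel of one of them, so for each single word some coordinate can be made compatible by a correction
of `ψ` that the word does not see (`exists_lift_fourCharacter`); hence `K` is verbally closed. On the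
other hand, a finite system that holds in `G` and involves elements of order two has no solution in
the torsion-free group `K` (`not_isAlgebraicallyClosed_of_solution`), so `K` is not algebraically
closed in `G`, let alone a retract.
-/

/-! ### Integers extended by a group acting through signs -/

/-- The semidirect product `ℤ^ι ⋊ Q`, where `q : Q` multiplies the `i`-th coordinate by the sign
`χ i q`. -/
@[ext]
structure SignedProduct {ι Q : Type*} [Group Q] (χ : ι → Q →* ℤˣ) where
  vec : ι → ℤ
  base : Q

namespace SignedProduct

variable {ι Q : Type*} [Group Q] {χ : ι → Q →* ℤˣ}

instance : Mul (SignedProduct χ) :=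
  ⟨fun x y => ⟨fun i => x.vec i + χ i x.base * y.vec i, x.base * y.base⟩⟩

instance : One (SignedProduct χ) := ⟨⟨0, 1⟩⟩

instance : Inv (SignedProduct χ) :=
  ⟨fun x => ⟨fun i => -((χ i x.base⁻¹ : ℤˣ) * x.vec i), x.base⁻¹⟩⟩

@[simp] lemma vec_mul (x y : SignedProduct χ) (i : ι) :
    (x * y).vec i = x.vec i + χ i x.base * y.vec i := rfl

@[simp] lemma base_mul (x y : SignedProduct χ) : (x * y).base = x.base * y.base := rfl

@[simp] lemma vec_one (i : ι) : (1 : SignedProduct χ).vec i = 0 := rfl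

@[simp] lemma base_one : (1 : SignedProduct χ).base = 1 := rfl

@[simp] lemma vec_inv (x : SignedProduct χ) (i : ι) :
    x⁻¹.vec i = -((χ i x.base⁻¹ : ℤˣ) * x.vec i) := rfl

@[simp] lemma base_inv (x : SignedProduct χ) : x⁻¹.base = x.base⁻¹ := rfl

instance : Group (SignedProduct χ) :=
  Group.ofLeftAxioms
    (fun x y z => by
      ext i
      · simp only [vec_mul, base_mul, map_mul, Units.val_mul]; ring
      · simp [mul_assoc])
    (fun x => by ext i <;> simp)
    (fun x => by ext i <;> simp)

/-- The projection `ℤ^ι ⋊ Q → Q`. -/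
def baseHom : SignedProduct χ →* Q where
  toFun := base
  map_one' := rfl
  map_mul' _ _ := rfl

@[simp] lemma baseHom_apply (x : SignedProduct χ) : baseHom x = x.base := rfl

end SignedProduct

/-! ### Cocycles with values in a twisted copy of the integers -/

/-- The `ℤ`-module of 1-cocycles of `Γ` with values in `ℤ`, on which `Γ` acts through the sign
character `χ`. -/
def signCocycles {Γ : Type*} [Group Γ] (χ : Γ →* ℤˣ) : Submodule ℤ (Γ → ℤ) where
  carrier := {c | ∀ g h, c (g * h) = c g + χ g * c h}
  zero_mem' := by simp
  add_mem' {c d} hc hd g h := by simp only [Pi.add_apply, hc g h, hd g h]; ring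
  smul_mem' m c hc g h := by simp only [Pi.smul_apply, hc g h, smul_eq_mul]; ring

section Cocycles

variable {Γ : Type*} [Group Γ] {χ : Γ →* ℤˣ} {c : Γ → ℤ}

lemma cocycle_mul (hc : c ∈ signCocycles χ) (g h : Γ) : c (g * h) = c g + χ g * c h := hc g h

lemma cocycle_one (hc : c ∈ signCocycles χ) : c 1 = 0 := by
  simpa using cocycle_mul hc 1 1

lemma cocycle_inv (hc : c ∈ signCocycles χ) (g : Γ) : c g⁻¹ = -(χ g * c g) := by
  have h := cocycle_mul hc g g⁻¹
  rw [mul_inv_cancel, cocycle_one hc] at h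
  rcases Int.units_eq_one_or (χ g) with hg | hg <;> simp [hg] at h ⊢ <;> linarith

lemma cocycle_pow (hc : c ∈ signCocycles χ) {g : Γ} (hg : χ g = 1) (n : ℕ) :
    c (g ^ n) = n * c g := by
  induction n with
  | zero => simp [cocycle_one hc]
  | succ n ih => rw [pow_succ, cocycle_mul hc, ih]; simp [hg]; ring

lemma cocycle_zpow (hc : c ∈ signCocycles χ) {g : Γ} (hg : χ g = 1) (n : ℤ) :
    c (g ^ n) = n * c g := by
  obtain ⟨m, rfl | rfl⟩ := n.eq_nat_or_neg
  · simpa using cocycle_pow hc hg m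
  · rw [zpow_neg, cocycle_inv hc, zpow_natCast, cocycle_pow hc hg]; simp [hg]

lemma cocycle_conj (hc : c ∈ signCocycles χ) {r : Γ} (hr : χ r = 1) (g : Γ) :
    c (g * r * g⁻¹) = χ g * c r := by
  rw [cocycle_mul hc, cocycle_mul hc, cocycle_inv hc, map_mul, hr]
  rcases Int.units_eq_one_or (χ g) with hg | hg <;> simp [hg]

lemma cocycle_comp {Γ' : Type*} [Group Γ'] (hc : c ∈ signCocycles χ) (f : Γ' →* Γ) :
    c ∘ f ∈ signCocycles (χ.comp f) := fun g h => by simp [cocycle_mul hc]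

/-- A cocycle that vanishes on the kernel of a surjection descends along it. -/
lemma exists_cocycle_comp_eq {G : Type*} [Group G] {π : Γ →* G} (hπ : Function.Surjective π)
    {χ : G →* ℤˣ} (hc : c ∈ signCocycles (χ.comp π)) (h0 : ∀ r ∈ π.ker, c r = 0) :
    ∃ d ∈ signCocycles χ, ∀ x, d (π x) = c x := by
  have key : ∀ x y, π x = π y → c x = c y := by
    intro x y hxy
    have h := h0 (x⁻¹ * y) (by rw [MonoidHom.mem_ker, map_mul, map_inv, hxy, inv_mul_cancel])
    rw [cocycle_mul hc, cocycle_inv hc] at h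
    rcases Int.units_eq_one_or (χ (π x)) with hg | hg <;> simp [hg] at h <;> linarith
  have hd : ∀ x, c (Function.surjInv hπ (π x)) = c x := fun x =>
    key _ _ (Function.surjInv_eq hπ (π x))
  refine ⟨fun g => c (Function.surjInv hπ g), fun g h => ?_, hd⟩
  obtain ⟨x, rfl⟩ := hπ g
  obtain ⟨y, rfl⟩ := hπ h
  simp only [← map_mul, hd, cocycle_mul hc, MonoidHom.comp_apply]

lemma signProduct_vec_mem {ι Q : Type*} [Group Q] {χ : ι → Q →* ℤˣ} (i : ι) :
    (fun x : SignedProduct χ => x.vec i) ∈ signCocycles ((χ i).comp SignedProduct.baseHom) :=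
  fun _ _ => rfl

/-- A cocycle of a free group is determined by its values on the free generators. -/
instance finite_signCocycles {n : ℕ} (χ : FreeGroup (Fin n) →* ℤˣ) :
    Module.Finite ℤ (signCocycles χ) := by
  let ev : signCocycles χ →ₗ[ℤ] (Fin n → ℤ) :=
    (LinearMap.funLeft ℤ ℤ (FreeGroup.of : Fin n → FreeGroup (Fin n))).comp
      (signCocycles χ).subtype
  refine Module.Finite.of_injective ev ((injective_iff_map_eq_zero _).2 ?_)
  rintro ⟨c, hc⟩ h
  have h0 : ∀ i, c (FreeGroup.of i) = 0 := fun i => congrFun h i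
  refine Subtype.ext (funext fun x => ?_)
  change c x = 0
  induction x using FreeGroup.induction_on with
  | C1 => exact cocycle_one hc
  | of i => exact h0 i
  | inv_of i => simp [cocycle_inv hc, h0 i]
  | mul x y hx hy => simp [cocycle_mul hc, hx, hy]

end Cocycles

/-! ### A certificate for the absence of a functional -/

/-- If no functional that vanishes on the submodule `L` takes the value `1` at `a`, then a single
integral combination of `a` and an element of `L` witnesses this: modulo `L` and torsion, `a` is a
multiple of some element by a nonunit. -/
lemma exists_functional_or_certificate {W : Type*} [AddCommGroup W] [Module.Finite ℤ W]
    (L : Submodule ℤ W) (a : W) :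
    (∃ x : W →ₗ[ℤ] ℤ, (∀ l ∈ L, x l = 0) ∧ x a = 1) ∨
      ∃ M : ℤ, M ≠ 0 ∧ ∃ l ∈ L, ∀ x : W →ₗ[ℤ] ℤ, M * x a - x l ≠ M := by
  let T := Submodule.torsion ℤ (W ⧸ L)
  let q : W →ₗ[ℤ] (W ⧸ L) ⧸ T := T.mkQ.comp L.mkQ
  let b := Module.Free.chooseBasis ℤ ((W ⧸ L) ⧸ T)
  let I : Submodule ℤ ℤ := LinearMap.range (Module.Dual.eval ℤ _ (q a))
  obtain ⟨d, hd⟩ := (IsPrincipalIdealRing.principal I).principal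
  by_cases hu : IsUnit d
  · left
    have h1 : (1 : ℤ) ∈ I := by
      rw [hd, Submodule.mem_span_singleton]
      obtain ⟨e, he⟩ := hu.exists_left_inv
      exact ⟨e, he⟩
    obtain ⟨y, hy⟩ := h1
    refine ⟨y.comp q, fun l hl => ?_, hy⟩
    have : L.mkQ l = 0 := by simpa using hl
    simp [q, this]
  · right
    have hdvd : ∀ i, ∃ k, b.repr (q a) i = d * k := fun i => by
      have : b.coord i (q a) ∈ I := ⟨b.coord i, rfl⟩
      rw [hd, Submodule.mem_span_singleton] at this
      obtain ⟨k, hk⟩ := this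
      exact ⟨k, by rw [← b.coord_apply, ← hk, smul_eq_mul, mul_comm]⟩
    choose k hk using hdvd
    obtain ⟨v, hv⟩ : ∃ v, q v = ∑ i, k i • b i := by
      have hq : Function.Surjective q := (T.mkQ_surjective).comp L.mkQ_surjective
      exact hq _
    have hq0 : q (a - d • v) = 0 := by
      rw [map_sub, map_smul, hv, Finset.smul_sum, sub_eq_zero]
      conv_lhs => rw [← b.sum_repr (q a)]
      exact Finset.sum_congr rfl fun i _ => by rw [hk, mul_smul]
    have hT : L.mkQ (a - d • v) ∈ T := (Submodule.Quotient.mk_eq_zero T).1 hq0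
    obtain ⟨M, hM⟩ := (Submodule.mem_torsion_iff _).1 hT
    have hM0 : (M : ℤ) ≠ 0 := nonZeroDivisors.ne_zero M.2
    refine ⟨M, hM0, (M : ℤ) • (a - d • v), ?_, fun x hx => hu ?_⟩
    · rw [← Submodule.Quotient.mk_eq_zero]
      exact hM
    · simp only [map_smul, map_sub, smul_eq_mul] at hx
      refine IsUnit.of_mul_eq_one (x v) (mul_left_cancel₀ hM0 ?_)
      linarith

/-- Applied to the evaluations of cocycles on a subgroup `N` of the kernel of `χ`: either some
cocycle that vanishes on `N` has value `1` at `a`, or some `r ∈ N` certifies that none does. -/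
lemma exists_cocycle_or_certificate {n : ℕ} (χ : FreeGroup (Fin n) →* ℤˣ)
    (N : Subgroup (FreeGroup (Fin n))) (hN : N ≤ χ.ker) (a : FreeGroup (Fin n)) :
    (∃ c ∈ signCocycles χ, (∀ r ∈ N, c r = 0) ∧ c a = 1) ∨
      ∃ M : ℤ, M ≠ 0 ∧ ∃ r ∈ N, ∀ c ∈ signCocycles χ, M * c a - c r ≠ M := by
  let ev : FreeGroup (Fin n) → Module.Dual ℤ (signCocycles χ) := fun g =>
    (LinearMap.proj g).comp (signCocycles χ).subtype
  have hev : ∀ g (c : signCocycles χ), ev g c = (c : FreeGroup (Fin n) → ℤ) g := fun _ _ => rfl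
  let L : Submodule ℤ (Module.Dual ℤ (signCocycles χ)) :=
    { carrier := ev '' N
      zero_mem' := ⟨1, N.one_mem, LinearMap.ext fun c => cocycle_one c.2⟩
      add_mem' := by
        rintro _ _ ⟨r, hr, rfl⟩ ⟨s, hs, rfl⟩
        refine ⟨r * s, N.mul_mem hr hs, LinearMap.ext fun c => ?_⟩
        have h1 : χ r = 1 := hN hr
        simp [hev, cocycle_mul c.2, h1]
      smul_mem' := by
        rintro m _ ⟨r, hr, rfl⟩
        refine ⟨r ^ m, N.zpow_mem hr m, LinearMap.ext fun c => ?_⟩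
        simp [hev, cocycle_zpow c.2 (hN hr)] }
  rcases exists_functional_or_certificate L (ev a) with ⟨x, hx0, hx1⟩ | ⟨M, hM, l, ⟨r, hr, rfl⟩, h⟩
  · left
    obtain ⟨c, rfl⟩ := (Module.evalEquiv ℤ (signCocycles χ)).surjective x
    exact ⟨c, c.2, fun r hr => hx0 (ev r) ⟨r, hr, rfl⟩, hx1⟩
  · exact Or.inr ⟨M, hM, r, hr, fun c hc =>
      h (Module.evalEquiv ℤ (signCocycles χ) ⟨c, hc⟩)⟩

/-! ### Projection onto a sign character -/

lemma exists_cocycle_sum {Γ ι : Type*} [Group Γ] (N : Subgroup Γ)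
    (hN : ∀ χ : Γ →* ℤˣ, N ≤ χ.ker) (r : ι → Γ) (hr : ∀ i, r i ∈ N) (s : Finset ι) :
    ∃ p ∈ N, ∀ χ : Γ →* ℤˣ, ∀ c ∈ signCocycles χ, c p = ∑ i ∈ s, c (r i) := by
  classical
  induction s using Finset.induction_on with
  | empty => exact ⟨1, N.one_mem, fun χ c hc => by simp [cocycle_one hc]⟩
  | insert i s hi ih =>
    obtain ⟨p, hp, h⟩ := ih
    refine ⟨r i * p, N.mul_mem (hr i) hp, fun χ c hc => ?_⟩
    have h1 : χ (r i) = 1 := hN χ (hr i)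
    rw [Finset.sum_insert hi, cocycle_mul hc, h1, h χ c hc, Units.val_one, one_mul]

/-- Elements `r χ`, one for each sign character, can be replaced by a single element `p` on which a
cocycle twisted by `χ` sees a fixed multiple of its value on `r χ` alone. The element `p` is a
product of conjugates of the `(r χ)^{±1}`, arranged so that the contributions of the other
characters cancel by orthogonality. -/
lemma exists_sign_projection {Γ : Type*} [Group Γ] [Finite (Γ →* ℤˣ)] (N : Subgroup Γ) [N.Normal]
    (hN : ∀ χ : Γ →* ℤˣ, N ≤ χ.ker) (r : (Γ →* ℤˣ) → Γ) (hr : ∀ χ, r χ ∈ N) :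
    ∃ e : ℕ, e ≠ 0 ∧ ∃ p ∈ N, ∀ χ : Γ →* ℤˣ, ∀ c ∈ signCocycles χ, c p = e * c (r χ) := by
  classical
  have := Fintype.ofFinite (Γ →* ℤˣ)
  let ev : Γ →* ((Γ →* ℤˣ) → ℤˣ) := MonoidHom.pi fun χ => χ
  have := Fintype.ofFinite ev.range
  let coord : (Γ →* ℤˣ) → (ev.range →* ℤˣ) := fun χ =>
    (Pi.evalMonoidHom _ χ).comp ev.range.subtype
  choose lift hlift using fun e : ev.range => e.2
  have hcoord : ∀ χ e, χ (lift e) = coord χ e := fun χ e => congrFun (hlift e) χ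
  have orth : ∀ χ χ', ∑ e, ((coord χ e : ℤ) * (coord χ' e : ℤ)) =
      if χ = χ' then (Fintype.card ev.range : ℤ) else 0 := by
    intro χ χ'
    split_ifs with h
    · subst h
      simp [← Units.val_mul]
    · let φ : ev.range →* ℤ := (Units.coeHom ℤ).comp (coord χ * coord χ')
      have hφ : φ ≠ 1 := by
        intro h1
        refine h (MonoidHom.ext fun g => ?_)
        have h2 : coord χ ⟨ev g, g, rfl⟩ * coord χ' ⟨ev g, g, rfl⟩ = 1 :=
          Units.ext (DFunLike.congr_fun h1 ⟨ev g, g, rfl⟩)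
        have h3 : χ g * χ' g = 1 := h2
        rw [mul_eq_one_iff_eq_inv] at h3
        rw [h3, Int.units_inv_eq_self]
      exact sum_hom_units_eq_zero φ hφ
  let t : (Γ →* ℤˣ) × ev.range → Γ := fun i =>
    (lift i.2 * r i.1 * (lift i.2)⁻¹) ^ (coord i.1 i.2 : ℤ)
  have ht : ∀ i, t i ∈ N := fun i => N.zpow_mem (Subgroup.Normal.conj_mem ‹_› _ (hr _) _) _
  obtain ⟨p, hp, h⟩ := exists_cocycle_sum N hN t ht Finset.univ
  refine ⟨Fintype.card ev.range, Fintype.card_ne_zero, p, hp, fun χ c hc => ?_⟩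
  have hterm : ∀ i, c (t i) = ((coord i.1 i.2 : ℤ) * (coord χ i.2 : ℤ)) * c (r i.1) := by
    intro i
    have h1 : χ (lift i.2 * r i.1 * (lift i.2)⁻¹) = 1 :=
      hN χ (Subgroup.Normal.conj_mem ‹_› _ (hr _) _)
    simp only [t]
    rw [cocycle_zpow hc h1, cocycle_conj hc (hN χ (hr _)), hcoord, mul_assoc]
  rw [h χ c hc, Finset.sum_congr rfl fun i _ => hterm i, Fintype.sum_prod_type]
  simp only [← Finset.sum_mul, orth]
  simp

/-! ### The Klein bottle group -/

namespace KleinBottleGroup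

/-- The sign `(-1)^j`, as a character of `ℤ`. -/
def paritySign : Multiplicative ℤ →* ℤˣ := zpowersHom ℤˣ (-1)

lemma paritySign_ofAdd_one : paritySign (Multiplicative.ofAdd 1) = -1 := by
  simp [paritySign]

/-- The generator `a`. -/
def a : KleinBottleGroup := PresentedGroup.of 0

/-- The generator `b`. -/
def b : KleinBottleGroup := PresentedGroup.of 1

lemma relation : b⁻¹ * a * b * a = 1 :=
  PresentedGroup.one_of_mem (rels := {(FreeGroup.of 1)⁻¹ * FreeGroup.of 0 * FreeGroup.of 1 *
    FreeGroup.of (0 : Fin 2)}) rfl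

lemma semiconjBy_zpow (j : Multiplicative ℤ) (k : ℤ) :
    SemiconjBy (b ^ j.toAdd) (a ^ k) (a ^ ((paritySign j : ℤ) * k)) := by
  have h1 : SemiconjBy b⁻¹ a a⁻¹ := by
    have h := eq_inv_of_mul_eq_one_left relation
    rw [SemiconjBy, ← h]
    group
  have h2 : SemiconjBy b a a⁻¹ := by simpa using h1.inv_symm_left.inv_right
  induction j using Multiplicative.rec with | ofAdd j =>
  induction j using Int.induction_on generalizing k with
  | zero => simp [SemiconjBy]
  | succ j ih =>
    have := (ih (-k)).mul_left (by simpa using h2.zpow_right k : SemiconjBy b (a ^ k) (a ^ (-k)))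
    simpa [zpow_add_one, ofAdd_add, paritySign_ofAdd_one] using this
  | pred j ih =>
    have := (ih (-k)).mul_left (by simpa using h1.zpow_right k : SemiconjBy b⁻¹ (a ^ k) (a ^ (-k)))
    simpa [zpow_sub_one, ofAdd_sub, ofAdd_neg, div_neg, paritySign_ofAdd_one]
      using this

/-- A cocycle and a homomorphism to `ℤ` whose parity is its sign make up a homomorphism to the
Klein bottle group. -/
def homOfCocycle {Γ : Type*} [Group Γ] (ψ : Γ →* Multiplicative ℤ) (c : Γ → ℤ)
    (hc : c ∈ signCocycles (paritySign.comp ψ)) : Γ →* KleinBottleGroup where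
  toFun g := a ^ c g * b ^ (ψ g).toAdd
  map_one' := by simp [cocycle_one hc]
  map_mul' g h := by
    rw [cocycle_mul hc, map_mul, toAdd_mul, zpow_add, zpow_add, MonoidHom.comp_apply]
    have := (semiconjBy_zpow (ψ g) (c h)).eq
    simp only [mul_assoc]
    rw [← mul_assoc _ (a ^ c h), this]
    simp only [mul_assoc]

/-- The map to the concrete model `ℤ ⋊ ℤ`, from which normal forms are read off. -/
def toModel : KleinBottleGroup →* SignedProduct fun _ : Unit => paritySign :=
  PresentedGroup.toGroup (f := ![⟨1, 1⟩, ⟨0, Multiplicative.ofAdd 1⟩]) (by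
    rintro r rfl
    ext i <;> simp [paritySign_ofAdd_one])

/-- The exponent of `b`, as a homomorphism. -/
def bExp : KleinBottleGroup →* Multiplicative ℤ := SignedProduct.baseHom.comp toModel

/-- The exponent of `a` in the normal form `a ^ i * b ^ j`. -/
def aExp (x : KleinBottleGroup) : ℤ := (toModel x).vec ()

@[simp] lemma bExp_a : bExp a = 1 := by
  simp [bExp, a, toModel]

@[simp] lemma bExp_b : bExp b = Multiplicative.ofAdd 1 := by
  simp [bExp, b, toModel]

@[simp] lemma aExp_a : aExp a = 1 := by
  simp [aExp, a, toModel]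

@[simp] lemma aExp_b : aExp b = 0 := by
  simp [aExp, b, toModel]

lemma aExp_mem : aExp ∈ signCocycles (paritySign.comp bExp) :=
  cocycle_comp (signProduct_vec_mem ()) toModel

lemma normal_form (x : KleinBottleGroup) : a ^ aExp x * b ^ (bExp x).toAdd = x := by
  have : homOfCocycle bExp aExp aExp_mem = MonoidHom.id _ := by
    refine PresentedGroup.ext fun i => ?_
    fin_cases i
    · change a ^ aExp a * b ^ (bExp a).toAdd = a
      simp
    · change a ^ aExp b * b ^ (bExp b).toAdd = b
      simp
  exact DFunLike.congr_fun this x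

end KleinBottleGroup

open KleinBottleGroup

/-! ### Verbally closed copies of the Klein bottle group in finitely generated groups -/

lemma isVerballyClosed_range_iff {H G : Type*} [Group H] [Group G] {f : H →* G}
    (hf : Function.Injective f) :
    f.range.IsVerballyClosed ↔ ∀ (n : ℕ) (π : FreeGroup (Fin n) →* G) (w : FreeGroup (Fin n))
      (h : H), π w = f h → ∃ θ : FreeGroup (Fin n) →* H, θ w = h := by
  constructor
  · intro hv n π w h hw
    obtain ⟨y, hy⟩ := hv n w ⟨f h, h, rfl⟩ ⟨FreeGroup.lift.symm π, by
      rw [Equiv.apply_symm_apply]; exact hw⟩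
    let e := MonoidHom.ofInjective hf
    refine ⟨e.symm.toMonoidHom.comp (FreeGroup.lift y), ?_⟩
    rw [MonoidHom.comp_apply, hy]
    exact e.symm_apply_apply h
  · rintro hv n w ⟨_, h, rfl⟩ ⟨x, hx⟩
    obtain ⟨θ, hθ⟩ := hv n (FreeGroup.lift x) w h hx
    refine ⟨FreeGroup.lift.symm (f.rangeRestrict.comp θ), ?_⟩
    rw [Equiv.apply_symm_apply, MonoidHom.comp_apply, hθ]
    rfl

section Verbal

variable {G : Type*} [Group G] {f : KleinBottleGroup →* G} {n : ℕ}
  {π : FreeGroup (Fin n) →* G}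

/-- If no homomorphism to `ℤ` took the value `1` at `b`, then `b ^ M` would be the value of a word
whose values in the Klein bottle group all differ from `b ^ M`. -/
lemma exists_hom_int_apply_b (hπ : Function.Surjective π)
    (hv : ∀ (w : FreeGroup (Fin n)) (h : KleinBottleGroup), π w = f h →
      ∃ θ : FreeGroup (Fin n) →* KleinBottleGroup, θ w = h) :
    ∃ ψ : G →* Multiplicative ℤ, ψ (f b) = Multiplicative.ofAdd 1 := by
  obtain ⟨y, hy⟩ := hπ (f b)
  rcases exists_cocycle_or_certificate 1 π.ker (fun _ _ => rfl) y with
    ⟨c, hc, hc0, hcy⟩ | ⟨M, -, r, hr, h⟩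
  · obtain ⟨d, hd, hdc⟩ := exists_cocycle_comp_eq (χ := 1) hπ hc hc0
    refine ⟨MonoidHom.mk' (fun g => Multiplicative.ofAdd (d g)) fun g g' => ?_, ?_⟩
    · simp [cocycle_mul hd]
    · simp [← hy, hdc, hcy]
  · exfalso
    obtain ⟨θ, hθ⟩ := hv (y ^ M * r⁻¹) (b ^ M) (by
      rw [map_mul, map_inv, MonoidHom.mem_ker.1 hr, map_zpow, hy, map_zpow, inv_one, mul_one])
    have hc : (fun x => (bExp (θ x)).toAdd) ∈ signCocycles (1 : FreeGroup (Fin n) →* ℤˣ) :=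
      fun x z => by simp
    refine h _ hc ?_
    have := congrArg (fun x => (bExp x).toAdd) hθ
    simp only [map_mul, map_inv, map_zpow, bExp_b, toAdd_mul, toAdd_inv, toAdd_zpow, toAdd_ofAdd]
      at this
    simp only [smul_eq_mul, mul_one] at this
    linarith

/-- If `G` has no sign character and cocycle of the required kind, then every sign character `χ` of
the free group has a certificate for this: no `χ`-cocycle takes the value `2 * M` at
`x ^ (2 * M) * r⁻¹`, a lift of `a ^ (2 * M)`. Squares are used because every sign character is trivial
on them, so that certificates for different characters can be combined. -/
lemma exists_signCharacter_or_certificate (hπ : Function.Surjective π) {x y : FreeGroup (Fin n)}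
    (hx : π x = f a) (hy : π y = f b) (χ : FreeGroup (Fin n) →* ℤˣ) :
    (∃ χ : G →* ℤˣ, χ (f a) = 1 ∧ χ (f b) = -1 ∧ ∃ c ∈ signCocycles χ, c (f a) = 1) ∨
      ∃ M : ℤ, M ≠ 0 ∧ ∃ r ∈ π.ker ⊓ ⨅ χ : FreeGroup (Fin n) →* ℤˣ, χ.ker,
        ∀ c ∈ signCocycles χ, M * c (x ^ 2) - c r ≠ 2 * M := by
  have two : ∀ (η : FreeGroup (Fin n) →* ℤˣ) g, η g * η g = 1 := fun η g => Int.units_mul_self _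
  have mem : ∀ r, π r = 1 → (∀ η : FreeGroup (Fin n) →* ℤˣ, η r = 1) →
      r ∈ π.ker ⊓ ⨅ χ : FreeGroup (Fin n) →* ℤˣ, χ.ker := fun r h1 h2 =>
    ⟨h1, (Subgroup.mem_iInf.2 fun η => h2 η : r ∈ ⨅ χ : FreeGroup (Fin n) →* ℤˣ, χ.ker)⟩
  by_cases hχx : χ x = 1
  swap
  · have hχx : χ x = -1 := (Int.units_eq_one_or _).resolve_left hχx
    -- all cocycles vanish at `x ^ 2`
    refine Or.inr ⟨1, one_ne_zero, 1, Subgroup.one_mem _, fun c hc => ?_⟩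
    simp [cocycle_one hc, sq, cocycle_mul hc, hχx]
  have hx2 : ∀ c ∈ signCocycles χ, c (x ^ 2) = 2 * c x := fun c hc => by
    simpa using cocycle_pow hc hχx 2
  by_cases hχy : χ y = 1
  · -- the defining relation is in the kernel, and cocycles see it as `x ^ 2`
    refine Or.inr ⟨1, one_ne_zero, x * (y⁻¹ * x * y), mem _ ?_ fun η => ?_, fun c hc => ?_⟩
    · have h := congrArg f relation
      simp only [map_mul, map_inv, map_one] at h
      rw [mul_eq_one_iff_eq_inv] at h
      simp [hx, hy, h]
    · rw [map_mul, map_mul, map_mul, map_inv, mul_right_comm _ (η x), inv_mul_cancel, one_mul, two]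
    · rw [hx2 c hc]
      simp [cocycle_mul hc, cocycle_inv hc, hχx, hχy]
      omega
  have hχy : χ y = -1 := (Int.units_eq_one_or _).resolve_left hχy
  by_cases hker : π.ker ≤ χ.ker
  swap
  · obtain ⟨s, hs, hχs⟩ := SetLike.not_le_iff_exists.1 hker
    have hχs : χ s = -1 := (Int.units_eq_one_or _).resolve_left hχs
    -- `χ` does not factor through `G`, and cocycles see the commutator of `x` and `s` as `x ^ 2`
    refine Or.inr ⟨1, one_ne_zero, x * (s * x⁻¹ * s⁻¹), mem _ ?_ fun η => ?_, fun c hc => ?_⟩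
    · simp [MonoidHom.mem_ker.1 hs]
    · rw [map_mul, map_mul, map_mul, map_inv, map_inv, mul_right_comm (η s),
        mul_inv_cancel, one_mul, mul_inv_cancel]
    · rw [hx2 c hc]
      simp [cocycle_mul hc, cocycle_inv hc, hχx, hχs]
      omega
  let χG : G →* ℤˣ := MonoidHom.liftOfSurjective π hπ ⟨χ, hker⟩
  have hχG : χG.comp π = χ := MonoidHom.liftOfRightInverse_comp _ _ _ _
  have hχG' : ∀ z, χG (π z) = χ z := fun z => DFunLike.congr_fun hχG z
  rcases exists_cocycle_or_certificate χ π.ker hker x with ⟨c, hc, hc0, hcx⟩ | ⟨M, hM, r, hr, h⟩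
  · rw [← hχG] at hc
    obtain ⟨d, hd, hdc⟩ := exists_cocycle_comp_eq hπ hc hc0
    refine Or.inl ⟨χG, ?_, ?_, d, hd, ?_⟩
    · rw [← hx, hχG', hχx]
    · rw [← hy, hχG', hχy]
    · rw [← hx, hdc, hcx]
  · refine Or.inr ⟨M, hM, r ^ 2, mem _ (Subgroup.pow_mem _ hr 2) fun η => ?_,
      fun c hc hcr => h c hc ?_⟩
    · rw [map_pow, sq, two]
    · rw [hx2 c hc, cocycle_pow hc (hker hr)] at hcr
      push_cast at hcr
      linarith

/-- The certificates for all sign characters of the free group assemble into a single word with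
value a power of `a` in `G` which takes that value nowhere in the Klein bottle group; hence one of
the characters has no certificate. -/
lemma exists_signCharacter (hπ : Function.Surjective π)
    (hv : ∀ (w : FreeGroup (Fin n)) (h : KleinBottleGroup), π w = f h →
      ∃ θ : FreeGroup (Fin n) →* KleinBottleGroup, θ w = h) :
    ∃ χ : G →* ℤˣ, χ (f a) = 1 ∧ χ (f b) = -1 ∧ ∃ c ∈ signCocycles χ, c (f a) = 1 := by
  classical
  by_contra hbad
  obtain ⟨x, hx⟩ := hπ (f a)
  obtain ⟨y, hy⟩ := hπ (f b)
  choose M hM r hr h using fun χ =>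
    (exists_signCharacter_or_certificate hπ hx hy χ).resolve_left hbad
  have : Finite (FreeGroup (Fin n) →* ℤˣ) := Finite.of_equiv _ FreeGroup.lift
  have := Fintype.ofFinite (FreeGroup (Fin n) →* ℤˣ)
  let N := π.ker ⊓ ⨅ χ : FreeGroup (Fin n) →* ℤˣ, χ.ker
  have hN : ∀ χ : FreeGroup (Fin n) →* ℤˣ, N ≤ χ.ker := fun χ =>
    inf_le_right.trans (iInf_le _ χ)
  have : (⨅ χ : FreeGroup (Fin n) →* ℤˣ, χ.ker).Normal := Subgroup.normal_iInf_normal inferInstance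
  have : N.Normal := Subgroup.normal_inf_normal _ _
  -- `M χ * k χ` does not depend on `χ`
  let k : (FreeGroup (Fin n) →* ℤˣ) → ℤ := fun χ => ∏ η ∈ Finset.univ.erase χ, M η
  have hk : ∀ χ, k χ ≠ 0 := fun χ => Finset.prod_ne_zero_iff.2 fun η _ => hM η
  have hMk : ∀ χ, M χ * k χ = ∏ η, M η := fun χ =>
    Finset.mul_prod_erase _ _ (Finset.mem_univ χ)
  obtain ⟨e, he, p, hp, hcp⟩ := exists_sign_projection N hN (fun χ => r χ ^ k χ)
    fun χ => N.zpow_mem (hr χ) _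
  obtain ⟨θ, hθ⟩ := hv ((x ^ 2) ^ (e * ∏ η, M η) * p⁻¹) ((a ^ 2) ^ (e * ∏ η, M η)) (by
    rw [map_mul, map_inv, MonoidHom.mem_ker.1 hp.1]
    simp [hx])
  let χ := (paritySign.comp bExp).comp θ
  have hc : aExp ∘ θ ∈ signCocycles χ := cocycle_comp aExp_mem θ
  have hχx : χ (x ^ 2) = 1 := by rw [map_pow, sq, Int.units_mul_self]
  have hχp : χ p⁻¹ = 1 := by rw [map_inv, MonoidHom.mem_ker.1 (hN χ hp), inv_one]
  have h1 := congrArg aExp hθ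
  have ha : (paritySign.comp bExp) a = 1 := by simp
  have ha2 : (paritySign.comp bExp) (a ^ 2) = 1 := by simp
  rw [cocycle_zpow aExp_mem ha2, cocycle_pow aExp_mem ha, aExp_a] at h1
  change (aExp ∘ θ) _ = _ at h1
  rw [cocycle_mul hc, cocycle_zpow hc hχx, cocycle_inv hc, hcp χ _ hc,
    cocycle_zpow hc (hN χ (hr χ)), map_zpow, hχx, MonoidHom.mem_ker.1 (hN χ hp), ← hMk χ] at h1
  refine h χ _ hc (mul_left_cancel₀ (mul_ne_zero (Nat.cast_ne_zero.2 he) (hk χ)) ?_)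
  simp only [one_zpow, Units.val_one] at h1
  push_cast at h1
  linarith

end Verbal

/-- A cocycle and a homomorphism to `ℤ` give a retraction on the subgroup where the sign of the
cocycle is the parity of the homomorphism; this subgroup is the kernel of a sign character. -/
lemma exists_retract_index_le_two {G : Type*} [Group G] {f : KleinBottleGroup →* G}
    {ψ : G →* Multiplicative ℤ}
    (hψ : ψ (f b) = Multiplicative.ofAdd 1) {χ : G →* ℤˣ} (hχa : χ (f a) = 1)
    (hχb : χ (f b) = -1) {c : G → ℤ} (hc : c ∈ signCocycles χ) (hca : c (f a) = 1) :
    ∃ R : Subgroup G, (R.index = 1 ∨ R.index = 2) ∧ f.range ≤ R ∧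
      (f.range.subgroupOf R).IsRetract := by
  have hψa : ψ (f a) = 1 := by
    have h := congrArg (fun x => (ψ (f x)).toAdd) relation
    simp at h
    exact Multiplicative.toAdd.injective (by simp; omega)
  let ε : G →* ℤˣ := χ * paritySign.comp ψ
  have hεf : ε.comp f = 1 := by
    refine PresentedGroup.ext fun i => ?_
    fin_cases i
    · change χ (f a) * paritySign (ψ (f a)) = 1
      simp [hχa, hψa]
    · change χ (f b) * paritySign (ψ (f b)) = 1
      simp [hχb, hψ, paritySign_ofAdd_one]
  have hle : f.range ≤ ε.ker := by
    rintro _ ⟨x, rfl⟩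
    exact DFunLike.congr_fun hεf x
  refine ⟨ε.ker, ?_, hle, ?_⟩
  · rw [Subgroup.index_ker, ← Nat.dvd_prime Nat.prime_two]
    simpa using Subgroup.card_subgroup_dvd_card ε.range
  · -- shift by the cocycle `(χ - 1) / 2` so as to vanish at `b`
    let e : G → ℤ := fun g => if χ g = 1 then 0 else -1
    have hχ : ∀ g : ε.ker, χ g = paritySign (ψ g) := fun g => by
      have h : χ g * paritySign (ψ g) = 1 := g.2
      rw [mul_eq_one_iff_eq_inv] at h
      rw [h, Int.units_inv_eq_self]
    have he : e ∈ signCocycles χ := fun g h => by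
      rcases Int.units_eq_one_or (χ g) with hg | hg <;>
      rcases Int.units_eq_one_or (χ h) with hh | hh <;> simp [e, hg, hh]
    let d : G → ℤ := c + c (f b) • e
    have hd : d ∈ signCocycles χ := add_mem hc (Submodule.smul_mem _ _ he)
    have hda : d (f a) = 1 := by simp [d, e, hca, hχa]
    have hdb : d (f b) = 0 := by simp [d, e, hχb]
    let ρ : ε.ker →* KleinBottleGroup := homOfCocycle (ψ.comp ε.ker.subtype)
      (d ∘ ε.ker.subtype) (by
        have := cocycle_comp hd ε.ker.subtype
        convert this using 1
        congr 1
        exact MonoidHom.ext fun g => (hχ g).symm)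
    let g : KleinBottleGroup →* ε.ker := f.codRestrict ε.ker fun x => hle ⟨x, rfl⟩
    have hρ : ρ.comp g = MonoidHom.id _ := by
      refine PresentedGroup.ext fun i => ?_
      fin_cases i
      · change a ^ d (f a) * b ^ (ψ (f a)).toAdd = a
        simp [hda, hψa]
      · change a ^ d (f b) * b ^ (ψ (f b)).toAdd = b
        simp [hdb, hψ]
    have hρ' : ∀ x, ρ (g x) = x := fun x => DFunLike.congr_fun hρ x
    refine ⟨g.comp ρ, MonoidHom.ext fun x => by simp [hρ'], ?_⟩
    ext x
    constructor
    · rintro ⟨z, rfl⟩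
      exact ⟨ρ z, rfl⟩
    · rintro ⟨z, hz⟩
      exact ⟨g z, by
        rw [MonoidHom.comp_apply, hρ']
        exact Subtype.ext hz⟩

lemma isRetract_of_index_eq_one {G : Type*} [Group G] {H R : Subgroup G} (hR : R.index = 1)
    (h : (H.subgroupOf R).IsRetract) : H.IsRetract := by
  obtain rfl := Subgroup.index_eq_one.1 hR
  obtain ⟨ρ, hρ, hr⟩ := h
  let e : (⊤ : Subgroup G) ≃* G := Subgroup.topEquiv
  refine ⟨e.toMonoidHom.comp (ρ.comp e.symm.toMonoidHom), ?_, ?_⟩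
  · ext x
    have := DFunLike.congr_fun hρ (e.symm x)
    simpa using congrArg e this
  · ext x
    have : e.symm x ∈ ρ.range ↔ x ∈ H := by rw [hr]; rfl
    rw [← this]
    constructor
    · rintro ⟨z, rfl⟩
      exact ⟨e.symm z, by simp⟩
    · rintro ⟨z, hz⟩
      exact ⟨e z, by simp [hz]⟩

/-- A verbally closed Klein bottle group in a finitely generated group is a retract of a subgroup of
index at most two. -/
theorem exists_retract_of_isVerballyClosed {G : Type*} [Group G] {f : KleinBottleGroup →* G}
    (hG : Group.FG G) (hf : Function.Injective f) (hv : f.range.IsVerballyClosed) :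
    ∃ R : Subgroup G, (R.index = 1 ∨ R.index = 2) ∧ f.range ≤ R ∧
      (f.range.subgroupOf R).IsRetract ∧ (¬ f.range.IsRetract → R.index = 2) := by
  obtain ⟨α, _, φ, hφ⟩ := Group.fg_iff_exists_freeGroup_hom_surjective_finite.1 hG
  obtain ⟨n, ⟨e⟩⟩ := Finite.exists_equiv_fin α
  let π : FreeGroup (Fin n) →* G := φ.comp (FreeGroup.freeGroupCongr e.symm).toMonoidHom
  have hπ : Function.Surjective π := hφ.comp (FreeGroup.freeGroupCongr e.symm).surjective
  have hv' := (isVerballyClosed_range_iff hf).1 hv n π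
  obtain ⟨ψ, hψ⟩ := exists_hom_int_apply_b hπ hv'
  obtain ⟨χ, hχa, hχb, c, hc, hca⟩ := exists_signCharacter hπ hv'
  obtain ⟨R, hR, hle, hret⟩ := exists_retract_index_le_two hψ hχa hχb hc hca
  exact ⟨R, hR, hle, hret, fun hn =>
    hR.resolve_left fun h1 => hn (isRetract_of_index_eq_one h1 hret)⟩

/-! ### A verbally closed Klein bottle group that is not algebraically closed -/

lemma isAlgebraicallyClosed_of_isRetract {G : Type*} [Group G] {H : Subgroup G}
    (h : H.IsRetract) : H.IsAlgebraicallyClosed := by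
  obtain ⟨ρ, hρ, rfl⟩ := h
  rintro n S - ⟨x, hx⟩
  refine ⟨fun i => ρ.rangeRestrict (x i), fun w hw => ?_⟩
  have key : Monoid.Coprod.lift (MonoidHom.id ρ.range)
      (FreeGroup.lift fun i => ρ.rangeRestrict (x i)) =
      ρ.rangeRestrict.comp (Monoid.Coprod.lift ρ.range.subtype (FreeGroup.lift x)) := by
    refine Monoid.Coprod.hom_ext ?_ ?_
    · ext ⟨_, z, rfl⟩
      exact (DFunLike.congr_fun hρ z).symm
    · ext i
      simp
  rw [key, MonoidHom.comp_apply, hx w hw, map_one]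

lemma eq_one_of_sq_eq_one {x : KleinBottleGroup} (hx : x ^ 2 = 1) : x = 1 := by
  have hb : bExp x = 1 := by
    have h := congrArg (fun z => (bExp z).toAdd) hx
    simp only [map_pow, toAdd_pow, map_one, toAdd_one] at h
    exact Multiplicative.toAdd.injective (by simpa using h)
  have ha : aExp x = 0 := by
    have h := congrArg aExp hx
    rw [cocycle_pow aExp_mem (by simp [hb]), cocycle_one aExp_mem] at h
    simpa using h
  rw [← normal_form x, ha, hb]
  simp

/-- The system `a = x₀x₁x₂`, `s² = t² = 1`, `x₀ᵗ = x₀⁻¹`, `x₁ˢ = x₁⁻¹`, `x₂ˢ = x₂⁻¹` has no solution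
in the Klein bottle group, which is torsion-free. -/
lemma not_isAlgebraicallyClosed_of_solution {G : Type*} [Group G] {f : KleinBottleGroup →* G}
    (hf : Function.Injective f) {x₀ x₁ x₂ s t : G} (hx : x₀ * x₁ * x₂ = f a) (hs : s ^ 2 = 1)
    (ht : t ^ 2 = 1) (h₀ : t⁻¹ * x₀ * t * x₀ = 1) (h₁ : s⁻¹ * x₁ * s * x₁ = 1)
    (h₂ : s⁻¹ * x₂ * s * x₂ = 1) : ¬ f.range.IsAlgebraicallyClosed := by
  intro hac
  let X : Fin 5 → Monoid.Coprod f.range (FreeGroup (Fin 5)) := fun i =>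
    Monoid.Coprod.inr (FreeGroup.of i)
  let A : Monoid.Coprod f.range (FreeGroup (Fin 5)) := Monoid.Coprod.inl ⟨f a, a, rfl⟩
  obtain ⟨y, hy⟩ := hac 5 {A⁻¹ * (X 0 * X 1 * X 2), X 3 ^ 2, X 4 ^ 2, (X 4)⁻¹ * X 0 * X 4 * X 0,
    (X 3)⁻¹ * X 1 * X 3 * X 1, (X 3)⁻¹ * X 2 * X 3 * X 2} (by simp)
    ⟨![x₀, x₁, x₂, s, t], by
      simp only [Set.forall_mem_insert, Set.mem_singleton_iff, forall_eq]
      simp [X, A, hx, hs, ht, h₀, h₁, h₂]⟩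
  have hinj : Function.Injective (MonoidHom.ofInjective hf).symm := MulEquiv.injective _
  have tf : ∀ z : f.range, z ^ 2 = 1 → z = 1 := fun z hz => by
    refine hinj ?_
    rw [map_one]
    exact eq_one_of_sq_eq_one (by rw [← map_pow, hz, map_one])
  simp only [Set.forall_mem_insert, Set.mem_singleton_iff, forall_eq] at hy
  simp only [X, A, map_mul, map_inv, map_pow, Monoid.Coprod.lift_apply_inl,
    Monoid.Coprod.lift_apply_inr, FreeGroup.lift_apply_of, MonoidHom.id_apply] at hy
  obtain ⟨e, e3, e4, e0, e1, e2⟩ := hy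
  rw [tf _ e3] at e1 e2
  rw [tf _ e4] at e0
  simp only [inv_one, one_mul, mul_one, ← sq] at e0 e1 e2
  rw [tf _ e0, tf _ e1, tf _ e2] at e
  have h1 : f a = 1 := by simpa using congrArg Subtype.val e
  have h2 : a = 1 := hf (by rw [h1, map_one])
  have := aExp_a
  rw [h2, cocycle_one aExp_mem] at this
  exact zero_ne_one this

/-- The three nontrivial characters of the Klein four-group. Every element is in the kernel of one
of them. -/
def fourCharacter : Fin 3 → (ℤˣ × ℤˣ →* ℤˣ) :=
  ![MonoidHom.snd _ _, MonoidHom.fst _ _, MonoidHom.fst _ _ * MonoidHom.snd _ _]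

lemma exists_fourCharacter_eq_one (v : ℤˣ × ℤˣ) : ∃ k, fourCharacter k v = 1 := by
  obtain ⟨p, q⟩ := v
  rcases Int.units_eq_one_or q with rfl | rfl
  · exact ⟨0, rfl⟩
  rcases Int.units_eq_one_or p with rfl | rfl
  · exact ⟨1, rfl⟩
  · exact ⟨2, by simp [fourCharacter]⟩

/-- The signs through which `ℤ × (ℤ/2)²` acts on `ℤ³`. -/
def exampleSigns (k : Fin 3) : Multiplicative ℤ × (ℤˣ × ℤˣ) →* ℤˣ :=
  paritySign.comp (MonoidHom.fst _ _) * (fourCharacter k).comp (MonoidHom.snd _ _)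

/-- The group `ℤ³ ⋊ (ℤ × (ℤ/2)²)`. -/
abbrev ExampleGroup : Type := SignedProduct exampleSigns

/-- The embedding of the Klein bottle group with `a ↦ (1, 1, 1)` and `b` mapped to the generator of
the infinite cyclic factor. -/
def toExample : KleinBottleGroup →* ExampleGroup where
  toFun x := ⟨fun _ => aExp x, (bExp x, 1)⟩
  map_one' := by ext i <;> simp [cocycle_one aExp_mem]
  map_mul' x y := by ext i <;> simp [cocycle_mul aExp_mem, exampleSigns]

lemma toExample_injective : Function.Injective toExample := fun x y h => by
  have ha : aExp x = aExp y := congrFun (congrArg SignedProduct.vec h) 0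
  have hb : bExp x = bExp y := congrArg (fun z => z.base.1) h
  rw [← normal_form x, ← normal_form y, ha, hb]

lemma SignedProduct.group_fg {ι Q : Type*} [Finite ι] [Group Q] (χ : ι → Q →* ℤˣ)
    [Group.FG Q] : Group.FG (SignedProduct χ) := by
  let inl : Multiplicative (ι → ℤ) →* SignedProduct χ :=
    { toFun := fun v => ⟨v.toAdd, 1⟩
      map_one' := rfl
      map_mul' := fun v v' => by ext i <;> simp }
  let inr : Q →* SignedProduct χ :=
    { toFun := fun q => ⟨0, q⟩
      map_one' := rfl
      map_mul' := fun q q' => by ext i <;> simp }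
  have h : inl.range ⊔ inr.range = ⊤ := by
    refine eq_top_iff.2 fun x _ => ?_
    have hx : inl (Multiplicative.ofAdd x.vec) * inr x.base = x := by ext i <;> simp [inl, inr]
    rw [← hx]
    exact Subgroup.mul_mem_sup ⟨_, rfl⟩ ⟨_, rfl⟩
  rw [Group.fg_def, ← h]
  exact ((Group.fg_iff_subgroup_fg _).1 inferInstance).sup
    ((Group.fg_iff_subgroup_fg _).1 inferInstance)

lemma exists_eq_mul_primitive {n : ℕ} (v : Fin n → ℤ) :
    ∃ (d : ℤ) (p y : Fin n → ℤ), (∀ i, v i = d * p i) ∧ d * (∑ i, y i * p i) = d := by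
  by_cases hv : v = 0
  · exact ⟨0, 0, 0, by simp [hv], by simp⟩
  · obtain ⟨i, -⟩ := Function.ne_iff.1 hv
    obtain ⟨p, hp, hp1⟩ := Finset.extract_gcd v ⟨i, Finset.mem_univ i⟩
    obtain ⟨y, hy⟩ := Finset.gcd_eq_sum_mul Finset.univ p
    refine ⟨Finset.univ.gcd v, p, y, fun i => hp i (Finset.mem_univ i), ?_⟩
    rw [hp1] at hy
    have : ∑ i, y i * p i = 1 := by rw [hy]; exact Finset.sum_congr rfl fun _ _ => by ring
    rw [this, mul_one]

lemma paritySign_surjective : Function.Surjective paritySign := fun s => by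
  rcases Int.units_eq_one_or s with rfl | rfl
  · exact ⟨1, map_one _⟩
  · exact ⟨_, paritySign_ofAdd_one⟩

/-- For a word `w` and a homomorphism from the free group to the Klein four-group, one of the three
characters of the latter lifts to a homomorphism to `ℤ` that vanishes at `w`: if `w` has exponent
vector `d • p` with `p` primitive, a character that is trivial on the image of `p` does. -/
lemma exists_lift_fourCharacter {n : ℕ} (w : FreeGroup (Fin n))
    (κ : FreeGroup (Fin n) →* ℤˣ × ℤˣ) :
    ∃ (k : Fin 3) (δ : FreeGroup (Fin n) →* Multiplicative ℤ),
      δ w = 1 ∧ paritySign.comp δ = (fourCharacter k).comp κ := by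
  let ex : FreeGroup (Fin n) →* Multiplicative (Fin n → ℤ) :=
    FreeGroup.lift fun i => Multiplicative.ofAdd (Pi.single i 1)
  let dot : (Fin n → ℤ) → ((Fin n → ℤ) →+ ℤ) := fun t =>
    { toFun := fun v => ∑ i, t i * v i
      map_zero' := by simp
      map_add' := fun v v' => by simp [mul_add, Finset.sum_add_distrib] }
  obtain ⟨d, p, y, hd, hy⟩ := exists_eq_mul_primitive (ex w).toAdd
  obtain ⟨k, hk⟩ := exists_fourCharacter_eq_one (∏ i, κ (FreeGroup.of i) ^ p i)
  choose m hm using fun i => paritySign_surjective (fourCharacter k (κ (FreeGroup.of i)))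
  have hsum : paritySign (Multiplicative.ofAdd (∑ i, (m i).toAdd * p i)) = 1 := by
    rw [← hk, map_prod, ofAdd_sum, map_prod]
    refine Finset.prod_congr rfl fun i _ => ?_
    rw [map_zpow, ← hm, ← map_zpow]
    congr 1
    exact Multiplicative.toAdd.injective (by simp [mul_comm])
  obtain ⟨q, hq⟩ : Even (∑ i, (m i).toAdd * p i) := by
    by_contra hodd
    rw [Int.not_even_iff_odd] at hodd
    have : paritySign (Multiplicative.ofAdd (∑ i, (m i).toAdd * p i)) = -1 := by
      rw [paritySign, zpowersHom_apply, toAdd_ofAdd, hodd.neg_one_zpow]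
    rw [this] at hsum
    exact absurd hsum (by decide)
  -- correct the lift by an even multiple of a functional with value `1` at `p`
  let t : Fin n → ℤ := fun i => (m i).toAdd - (q + q) * y i
  refine ⟨k, (AddMonoidHom.toMultiplicative (dot t)).comp ex, ?_, ?_⟩
  · refine Multiplicative.toAdd.injective ?_
    change ∑ i, t i * (ex w).toAdd i = 0
    have : ∀ i, t i * (ex w).toAdd i =
        d * ((m i).toAdd * p i) - (q + q) * (d * (y i * p i)) := fun i => by
      rw [hd]; simp only [t]; ring
    rw [Finset.sum_congr rfl fun i _ => this i, Finset.sum_sub_distrib, ← Finset.mul_sum,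
      ← Finset.mul_sum, ← Finset.mul_sum, hy, hq]
    ring
  · ext i
    have h1 : (AddMonoidHom.toMultiplicative (dot t)).comp ex (FreeGroup.of i) =
        m i * (Multiplicative.ofAdd (q * y i) * Multiplicative.ofAdd (q * y i))⁻¹ := by
      refine Multiplicative.toAdd.injective ?_
      simp [ex, dot, t, Pi.single_apply]
      ring
    rw [MonoidHom.comp_apply, h1, map_mul, map_inv, map_mul, Int.units_mul_self, inv_one, mul_one,
      hm, MonoidHom.comp_apply]

/-- A word with value `toExample h` takes the value `h` in the Klein bottle group: of the three
coordinates of `ℤ³`, one has a sign which becomes the parity of a homomorphism to `ℤ` after a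
correction that does not affect the word. -/
lemma exists_hom_of_map_eq_toExample {n : ℕ} (π : FreeGroup (Fin n) →* ExampleGroup)
    (w : FreeGroup (Fin n)) (h : KleinBottleGroup) (hw : π w = toExample h) :
    ∃ θ : FreeGroup (Fin n) →* KleinBottleGroup, θ w = h := by
  let β := SignedProduct.baseHom.comp π
  obtain ⟨k, δ, hδ, hk⟩ := exists_lift_fourCharacter w ((MonoidHom.snd _ _).comp β)
  let ψ := (MonoidHom.fst _ _).comp β * δ
  have hc : (fun x => (π x).vec k) ∈ signCocycles (paritySign.comp ψ) := by
    have hχ : paritySign.comp ψ = ((exampleSigns k).comp SignedProduct.baseHom).comp π := by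
      ext x
      have hx := DFunLike.congr_fun hk (FreeGroup.of x)
      simp only [MonoidHom.comp_apply] at hx
      simp [ψ, exampleSigns, β, hx]
    rw [hχ]
    exact cocycle_comp (signProduct_vec_mem (χ := exampleSigns) k) π
  refine ⟨homOfCocycle ψ _ hc, ?_⟩
  change a ^ (π w).vec k * b ^ (ψ w).toAdd = h
  have hψ : ψ w = bExp h := by
    change (π w).base.1 * δ w = _
    rw [hδ, mul_one, hw]
    rfl
  rw [hψ, hw]
  exact normal_form h

/-- A finitely generated group, in an arbitrary universe, with a verbally closed copy of the Klein
bottle group that is not algebraically closed. -/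
theorem exists_isVerballyClosed_not_isAlgebraicallyClosed :
    ∃ (G : Type u) (_ : Group G) (f : KleinBottleGroup →* G), Group.FG G ∧
      Function.Injective f ∧ f.range.IsVerballyClosed ∧ ¬ f.range.IsAlgebraicallyClosed := by
  let up : ExampleGroup ≃* ULift.{u} ExampleGroup := MulEquiv.ulift.symm
  let f : KleinBottleGroup →* ULift.{u} ExampleGroup := up.toMonoidHom.comp toExample
  have hf : Function.Injective f := up.injective.comp toExample_injective
  let x : Fin 3 → ExampleGroup := fun i => ⟨Pi.single i 1, 1⟩
  let s : ExampleGroup := ⟨0, 1, -1, 1⟩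
  let t : ExampleGroup := ⟨0, 1, 1, -1⟩
  refine ⟨ULift.{u} ExampleGroup, inferInstance, f, ?_, hf, ?_, ?_⟩
  · have := SignedProduct.group_fg exampleSigns
    exact Group.fg_of_surjective (f := up.toMonoidHom) up.surjective
  · refine (isVerballyClosed_range_iff hf).2 fun n π w h hw => ?_
    refine exists_hom_of_map_eq_toExample (up.symm.toMonoidHom.comp π) w h ?_
    exact congrArg up.symm hw
  · refine not_isAlgebraicallyClosed_of_solution hf (x₀ := up (x 0)) (x₁ := up (x 1))
      (x₂ := up (x 2)) (s := up s) (t := up t) ?_ ?_ ?_ ?_ ?_ ?_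
    · rw [← map_mul, ← map_mul]
      refine congrArg up ?_
      ext i
      · fin_cases i <;> simp [x, toExample]
      all_goals simp [x, toExample]
    all_goals
      simp only [← map_mul, ← map_inv, ← map_pow]
      rw [map_eq_one_iff _ up.injective]
      ext i
      · fin_cases i <;> simp [x, s, t, sq, exampleSigns, fourCharacter]
      all_goals simp [x, s, t, sq]

/-! ### Conclusion -/

theorem mainTheorem1 :
    ¬ IsStronglyVerballyClosed.{u} KleinBottleGroup ∧
    (∃ (G : Type u) (_ : Group G) (f : KleinBottleGroup →* G),
      Group.FG G ∧ Function.Injective f ∧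
        f.range.IsVerballyClosed ∧ ¬ f.range.IsRetract) ∧
    (∀ (G : Type u) [Group G] (f : KleinBottleGroup →* G),
      Group.FG G → Function.Injective f → f.range.IsVerballyClosed →
        ∃ R : Subgroup G, (R.index = 1 ∨ R.index = 2) ∧ f.range ≤ R ∧
          (f.range.subgroupOf R).IsRetract ∧
          (¬ f.range.IsRetract → R.index = 2)) := by
  obtain ⟨G, _, f, hG, hf, hv, hac⟩ := exists_isVerballyClosed_not_isAlgebraicallyClosed.{u}
  exact ⟨fun h => hac (h G f hf hv),
    ⟨G, _, f, hG, hf, hv, fun hr => hac (isAlgebraicallyClosed_of_isRetract hr)⟩,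
    fun _ _ _ hG hf hv => exists_retract_of_isVerballyClosed hG hf hv⟩
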